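/- All digraphs are finite. An oriented graph is a digraph without loops and without pairs of opposite arcs. For an oriented graph $D$, let $\mathrm{fas}(D)$ be the minimum size of a set of arcs whose deletion makes $D$ acyclic. The inversion of a vertex set $X$ reverses all arcs with both endpoints in $X$. Let $\mathrm{inv}^{=p}(D)$ be the minimum number of successive inversions of vertex sets of size exactly $p$ that render $D$ acyclic ($+\infty$ if this is impossible). Let $p\ge 4$ be an even integer. Then, for every oriented graph $D$ of order $n\ge p+2$, the number $\mathrm{inv}^{=p}(D)$ is finite and (i) $\mathrm{inv}^{=p}(D)\le (2p-2)(\mathrm{fas}(D)+1)$; (ii) $\mathrm{inv}^{=p}(D)\le 2\,\mathrm{fas}(D)+2pn$; (iii) for every integer $k\ge 1$ with $n\ge p+2k-2$, $$\mathrm{inv}^{=p}(D)\le \mathrm{fas}(D)+\frac{p-2}{2}\,n^{1+1/k}+\Bigl((p-2)2^{k^2}+\frac{p-1}{2}\Bigr)n+1;$$ (iv) $\displaystyle \mathrm{inv}^{=p}(D)\le \frac{\mathrm{fas}(D)}{\lceil p/2\rceil\lfloor p/2\rfloor}+g_p(n)$, where $g_p:\mathbb N\to\mathbb R$ is a function depending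 only on $p$ with $g_p(n)=o(n^2)$ as $n\to\infty$. -/

import Mathlib

open Filter Asymptotics

universe u

namespace Digraph

/-- An oriented graph: no loops and no pair of opposite arcs (a loop would be its own opposite). -/
def IsOriented {V : Type u} (D : Digraph V) : Prop :=
  ∀ u v : V, D.Adj u v → ¬ D.Adj v u

/-- A digraph is acyclic if it has no directed cycle, equivalently no closed directed walk of
positive length. -/
def IsAcyclic {V : Type u} (D : Digraph V) : Prop :=
  ∀ v : V, ¬ Relation.TransGen D.Adj v v

/-- The digraph obtained by deleting the arcs in `F`. -/
def deleteArcs {V : Type u} (D : Digraph V) (F : Finset (V × V)) : Digraph V where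
  Adj u v := D.Adj u v ∧ (u, v) ∉ F

/-- A feedback arc set: a set of arcs whose deletion makes the digraph acyclic. -/
def IsFeedbackArcSet {V : Type u} (D : Digraph V) (F : Finset (V × V)) : Prop :=
  (∀ e ∈ F, D.Adj e.1 e.2) ∧ (D.deleteArcs F).IsAcyclic

/-- The feedback-arc-set number of a finite digraph: the minimum size of a feedback arc set.
(The set of all arcs is a feedback arc set, so for finite digraphs this is a minimum over a
nonempty set.) -/
noncomputable def fas {V : Type u} (D : Digraph V) : ℕ :=
  sInf {m : ℕ | ∃ F : Finset (V × V), D.IsFeedbackArcSet F ∧ F.card = m}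

/-- The inversion of a set `X` of vertices: reverse the arcs with both ends in `X`. -/
def invert {V : Type u} (D : Digraph V) (X : Finset V) : Digraph V where
  Adj u v := ((u ∈ X ∧ v ∈ X) ∧ D.Adj v u) ∨ (¬ (u ∈ X ∧ v ∈ X) ∧ D.Adj u v)

/-- The digraph obtained by inverting the members of a finite family one after another. -/
def invertFamily {V : Type u} (D : Digraph V) (L : List (Finset V)) : Digraph V :=
  L.foldl invert D

/-- A decycling `(=p)`-family: all its members have exactly `p` elements, and inverting all of
them yields an acyclic digraph. -/
def IsDecyclingEqFamily {V : Type u} (D : Digraph V) (p : ℕ) (L : List (Finset V)) : Prop :=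
  (∀ X ∈ L, X.card = p) ∧ (D.invertFamily L).IsAcyclic

/-- The `(=p)`-inversion number: the minimum number of `(=p)`-inversions rendering `D` acyclic,
or `⊤` if there is no decycling `(=p)`-family. -/
noncomputable def eqInvNumber {V : Type u} (D : Digraph V) (p : ℕ) : ℕ∞ :=
  ⨅ (L : List (Finset V)) (_ : D.IsDecyclingEqFamily p L), (L.length : ℕ∞)

end Digraph

/-!
Over the field with two elements, the inversion of `X` adds the clique on `X` to the set of edges
whose arcs are reversed. So it is enough to write, as a sum of few `p`-cliques, an edge set whose
reversal makes `D` acyclic: the backward arcs of a minimum feedback arc set and, if their number is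
odd, the edge between two consecutive vertices of the resulting order. The number of edges is then
even, as it has to be when `4 ∣ p`, since `p`-cliques have an even number of edges in that case.

The cliques on `Z ∪ {a, b}` for the edges `ab` of a 4-cycle, with a common set `Z` of size `p - 2`,
add up to that 4-cycle, and 4-cycles together with two more cliques give every path of length two.
Pairing the edges yields (i). For (ii), two adjacent edges `va`, `vb` are moved by one 4-cycle to
the edges `wa`, `wb` at a fixed vertex `w`, and the star at `w` that results costs `O(pn)`. For
(iii), one fixed `Z` serves all the edges avoiding `Z ∪ {w}`, so that each of them costs one clique
up to a star at `w`; this gives an error term linear in `n`. For (iv), four cliques add up to a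
`K_{p,p}`, and after a greedy removal of copies of `K_{p,p}` only `o(n²)` edges remain.
-/

namespace EqInversion

section EdgeSpace

variable {V : Type u} [DecidableEq V]

/-- The basis vector of the edge `e` in the edge space `Sym2 V → ZMod 2`. A set `F` of edges is
encoded by `∑ e ∈ F, edgeVec e`, so that reversing sets of edges one after another amounts to
adding vectors. -/
def edgeVec (e : Sym2 V) : Sym2 V → ZMod 2 :=
  Pi.single e 1

/-- The vector in the edge space of the edges of the star joining `a` to the vertices in `X`. -/
def starVec (a : V) (X : Finset V) : Sym2 V → ZMod 2 :=
  ∑ x ∈ X, edgeVec s(a, x)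

/-- The vector in the edge space of the edges between two disjoint vertex sets. -/
def joinVec (A B : Finset V) : Sym2 V → ZMod 2 :=
  ∑ a ∈ A, starVec a B

/-- The vector in the edge space of the edges inside `X`, that is, of the arcs which the inversion
of `X` reverses. -/
def cliqueVec (X : Finset V) : Sym2 V → ZMod 2 :=
  fun e => if e ∈ X.sym2 ∧ ¬ e.IsDiag then 1 else 0

theorem cliqueVec_mk (X : Finset V) (u v : V) :
    cliqueVec X s(u, v) = if (u ∈ X ∧ v ∈ X) ∧ u ≠ v then 1 else 0 := by
  simp [cliqueVec]

theorem starVec_apply (a b : V) (X : Finset V) :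
    starVec a X s(a, b) = if b ∈ X then 1 else 0 := by
  simp only [starVec, edgeVec, Finset.sum_apply, Pi.single_apply, Sym2.congr_right,
    Finset.sum_ite_eq]

theorem starVec_insert {a b : V} {X : Finset V} (hb : b ∉ X) :
    starVec a (insert b X) = edgeVec s(a, b) + starVec a X :=
  Finset.sum_insert hb

theorem cliqueVec_empty : cliqueVec (∅ : Finset V) = 0 := by
  ext e
  simp [cliqueVec]

theorem cliqueVec_insert {a : V} {X : Finset V} (ha : a ∉ X) :
    cliqueVec (insert a X) = cliqueVec X + starVec a X := by
  ext e
  induction e using Sym2.ind with | _ u v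
  simp only [Pi.add_apply, cliqueVec_mk]
  by_cases hu : u = a
  · subst hu
    by_cases hv : v = u <;> simp_all [starVec_apply, eq_comm]
  by_cases hv : v = a
  · subst hv
    rw [Sym2.eq_swap, starVec_apply]
    simp_all
  have h : starVec a X s(u, v) = 0 := by
    simp [starVec, edgeVec, hu, hv]
  simp [h, hu, hv]

theorem cliqueVec_union {A B : Finset V} (h : Disjoint A B) :
    cliqueVec (A ∪ B) = cliqueVec A + cliqueVec B + joinVec A B := by
  induction A using Finset.induction_on with
  | empty => simp [joinVec, cliqueVec_empty]
  | insert a A ha ih =>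
    rw [Finset.disjoint_insert_left] at h
    rw [Finset.insert_union, cliqueVec_insert (by simp [ha, h.1]), cliqueVec_insert ha, ih h.2,
      joinVec, joinVec, Finset.sum_insert ha, starVec, Finset.sum_union h.2, ← starVec, ← starVec]
    ring

end EdgeSpace

section Realizes

variable {V : Type u} [DecidableEq V] {p m n : ℕ} {f g : Sym2 V → ZMod 2}

/-- The set of edges encoded by `f` can be reversed by at most `m` inversions of sets of size
`p`. -/
def Realizes (p : ℕ) (f : Sym2 V → ZMod 2) (m : ℕ) : Prop :=
  ∃ L : List (Finset V), (∀ X ∈ L, X.card = p) ∧ L.length ≤ m ∧ (L.map cliqueVec).sum = f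

theorem Realizes.zero : Realizes p (0 : Sym2 V → ZMod 2) 0 :=
  ⟨[], by simp⟩

theorem Realizes.mono (h : Realizes p f m) (hmn : m ≤ n) : Realizes p f n :=
  let ⟨L, hL, hm, hf⟩ := h
  ⟨L, hL, hm.trans hmn, hf⟩

theorem Realizes.add (hf : Realizes p f m) (hg : Realizes p g n) : Realizes p (f + g) (m + n) := by
  obtain ⟨L, hL, hm, rfl⟩ := hf
  obtain ⟨L', hL', hn, rfl⟩ := hg
  refine ⟨L ++ L', fun X hX => ?_, ?_, by simp⟩
  · exact (List.mem_append.1 hX).elim (hL X) (hL' X)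
  · simpa using Nat.add_le_add hm hn

theorem realizes_cliqueVec (X : Finset V) : Realizes X.card (cliqueVec X) 1 :=
  ⟨[X], by simp⟩

theorem Realizes.sum {ι : Type*} {S : Finset ι} {f : ι → Sym2 V → ZMod 2}
    (h : ∀ i ∈ S, Realizes p (f i) m) : Realizes p (∑ i ∈ S, f i) (m * S.card) := by
  classical
  induction S using Finset.induction_on with
  | empty => exact Realizes.zero
  | insert i S hi ih =>
    rw [Finset.forall_mem_insert] at h
    rw [Finset.sum_insert hi, Finset.card_insert_of_notMem hi, mul_add_one, add_comm (m * _)]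
    exact h.1.add (ih h.2)

theorem Realizes.sum_of_even {ι : Type*} {S : Finset ι} {f : ι → Sym2 V → ZMod 2}
    (hS : Even S.card)
    (h : ∀ i ∈ S, ∀ j ∈ S, i ≠ j → Realizes p (f i + f j) (2 * m)) :
    Realizes p (∑ i ∈ S, f i) (m * S.card) := by
  classical
  induction S using Finset.strongInduction with
  | H S ih =>
    rcases S.eq_empty_or_nonempty with rfl | ⟨i, hi⟩
    · exact Realizes.zero
    have hi' := Finset.card_erase_add_one hi
    obtain ⟨j, hj⟩ : (S.erase i).Nonempty := by
      rw [← Finset.card_pos]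
      grind
    have hj' := Finset.card_erase_add_one hj
    have hsub : (S.erase i).erase j ⊆ S := (Finset.erase_subset _ _).trans (Finset.erase_subset _ _)
    have hrest := ih ((S.erase i).erase j)
      ((Finset.erase_subset _ _).trans_ssubset (Finset.erase_ssubset hi)) (by grind)
      fun x hx y hy => h x (hsub hx) y (hsub hy)
    have hpair := h i hi j (Finset.mem_of_mem_erase hj) (Finset.ne_of_mem_erase hj).symm
    rw [← Finset.add_sum_erase S f hi, ← Finset.add_sum_erase _ f hj, ← add_assoc]
    exact (hpair.add hrest).mono (by rw [← hi', ← hj']; exact le_of_eq (by ring))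

end Realizes

theorem two_eq_zero {V : Type u} : (2 : Sym2 V → ZMod 2) = 0 :=
  funext fun _ => CharTwo.two_eq_zero

section Gadgets

variable {V : Type u} [Fintype V] [DecidableEq V] {p m : ℕ}

omit [DecidableEq V] in
theorem exists_finset_disjoint_card_eq {X : Finset V} {m : ℕ} (h : X.card + m ≤ Fintype.card V) :
    ∃ Z, Disjoint X Z ∧ Z.card = m := by
  classical
  obtain ⟨Z, hZ, hm⟩ := Finset.exists_subset_card_eq (s := Xᶜ) (n := m) (by
    rw [Finset.card_compl]; omega)
  exact ⟨Z, (Finset.subset_compl_iff_disjoint_left.1 hZ), hm⟩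

omit [Fintype V] in
theorem cliqueVec_insert_insert {a b : V} {Z : Finset V} (hab : a ≠ b) (ha : a ∉ Z) (hb : b ∉ Z) :
    cliqueVec (insert a (insert b Z)) =
      edgeVec s(a, b) + starVec a Z + starVec b Z + cliqueVec Z := by
  rw [cliqueVec_insert (by simp [hab, ha]), cliqueVec_insert hb, starVec_insert hb]
  ring

omit [Fintype V] in
theorem realizes_cliqueVec_insert_insert {a b : V} {Z : Finset V} (hab : a ≠ b) (ha : a ∉ Z)
    (hb : b ∉ Z) (hZ : Z.card + 2 = p) :
    Realizes p (edgeVec s(a, b) + starVec a Z + starVec b Z + cliqueVec Z) 1 := by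
  have h := realizes_cliqueVec (insert a (insert b Z))
  rwa [cliqueVec_insert_insert hab ha hb, Finset.card_insert_of_notMem (by simp [hab, ha]),
    Finset.card_insert_of_notMem hb, hZ] at h

theorem realizes_fourCycle (hp : 2 ≤ p) (hn : p + 2 ≤ Fintype.card V) {a b c d : V} (hab : a ≠ b)
    (hac : a ≠ c) (had : a ≠ d) (hbc : b ≠ c) (hbd : b ≠ d) (hcd : c ≠ d) :
    Realizes p (edgeVec s(a, b) + edgeVec s(b, c) + edgeVec s(c, d) + edgeVec s(d, a)) 4 := by
  have hcard : ({a, b, c, d} : Finset V).card = 4 := by simp [hab, hac, had, hbc, hbd, hcd]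
  obtain ⟨Z, hdisj, hZ⟩ := exists_finset_disjoint_card_eq (X := {a, b, c, d}) (m := p - 2)
    (by omega)
  simp only [Finset.disjoint_insert_left, Finset.disjoint_singleton_left] at hdisj
  obtain ⟨ha, hb, hc, hd⟩ := hdisj
  have hZ' : Z.card + 2 = p := by omega
  convert (((realizes_cliqueVec_insert_insert hab ha hb hZ').add
    (realizes_cliqueVec_insert_insert hbc hb hc hZ')).add
    (realizes_cliqueVec_insert_insert hcd hc hd hZ')).add
    (realizes_cliqueVec_insert_insert had.symm hd ha hZ') using 1
  linear_combination -(starVec a Z + starVec b Z + starVec c Z + starVec d Z + 2 * cliqueVec Z) *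
    two_eq_zero

theorem realizes_starVec_add_starVec (hp : 2 ≤ p) (hn : p + 2 ≤ Fintype.card V) {a c : V}
    (hac : a ≠ c) {Z : Finset V} (ha : a ∉ Z) (hc : c ∉ Z) (hZ : Even Z.card) :
    Realizes p (starVec a Z + starVec c Z) (2 * Z.card) := by
  rw [starVec, starVec, ← Finset.sum_add_distrib]
  refine Realizes.sum_of_even hZ fun x hx y hy hxy => ?_
  convert realizes_fourCycle hp hn (ne_of_mem_of_not_mem hx ha).symm hac
    (ne_of_mem_of_not_mem hy ha).symm (ne_of_mem_of_not_mem hx hc) hxy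
    (ne_of_mem_of_not_mem hy hc).symm using 1
  rw [Sym2.eq_swap (a := x), Sym2.eq_swap (a := y)]
  ring

theorem realizes_path (hp : 2 ≤ p) (hp_even : Even p) (hn : p + 2 ≤ Fintype.card V) {a b c : V}
    (hab : a ≠ b) (hac : a ≠ c) (hbc : b ≠ c) :
    Realizes p (edgeVec s(a, b) + edgeVec s(b, c)) (2 * p - 2) := by
  have hcard : ({a, b, c} : Finset V).card = 3 := by simp [hab, hac, hbc]
  obtain ⟨Z, hdisj, hZ⟩ := exists_finset_disjoint_card_eq (X := {a, b, c}) (m := p - 2)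
    (by omega)
  simp only [Finset.disjoint_insert_left, Finset.disjoint_singleton_left] at hdisj
  obtain ⟨ha, hb, hc⟩ := hdisj
  have hZ' : Z.card + 2 = p := by omega
  have hZeven : Even Z.card := by grind
  have hcliques := (realizes_cliqueVec_insert_insert hab ha hb hZ').add
    (realizes_cliqueVec_insert_insert hbc hb hc hZ')
  convert (hcliques.add (realizes_starVec_add_starVec hp hn hac ha hc hZeven)).mono
    (by omega : 1 + 1 + 2 * Z.card ≤ 2 * p - 2) using 1
  linear_combination -(starVec a Z + starVec b Z + starVec c Z + cliqueVec Z) * two_eq_zero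

theorem realizes_edgeVec_add_edgeVec (hp : 2 ≤ p) (hp_even : Even p)
    (hn : p + 2 ≤ Fintype.card V) {e e' : Sym2 V} (he : ¬ e.IsDiag) (he' : ¬ e'.IsDiag)
    (hee' : e ≠ e') : Realizes p (edgeVec e + edgeVec e') (2 * (2 * p - 2)) := by
  by_cases hadj : ∃ v, v ∈ e ∧ v ∈ e'
  · obtain ⟨v, ⟨x, rfl⟩, ⟨y, rfl⟩⟩ := hadj
    rw [Sym2.mk_isDiag_iff] at he he'
    rw [Sym2.eq_swap (b := x)]
    exact (realizes_path hp hp_even hn (Ne.symm he) (fun hxy => hee' (hxy ▸ rfl)) he').mono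
      (by omega)
  · induction e using Sym2.ind with | _ a b
    induction e' using Sym2.ind with | _ c d
    rw [Sym2.mk_isDiag_iff] at he he'
    simp only [Sym2.mem_iff, not_exists, not_and, not_or, forall_eq_or_imp, forall_eq] at hadj
    obtain ⟨⟨hac, -⟩, hbc, hbd⟩ := hadj
    rw [two_mul]
    convert (realizes_path hp hp_even hn he hac hbc).add
      (realizes_path hp hp_even hn hbc hbd he') using 1
    linear_combination -edgeVec s(b, c) * two_eq_zero

end Gadgets

section StarReduction

variable {V : Type u} [Fintype V] [DecidableEq V] {p m m' : ℕ} {w : V}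
  {f g : Sym2 V → ZMod 2} {F : Finset (Sym2 V)}

/-- At most `m` inversions of sets of size `p` turn the set of edges encoded by `f` into a set of
edges at the vertex `w` with the same parity, encoded by its characteristic function `c` on the
other ends. -/
def ReducesToStar (p : ℕ) (w : V) (f : Sym2 V → ZMod 2) (m : ℕ) : Prop :=
  ∃ c : V → ZMod 2, c w = 0 ∧ ∑ v, c v = ∑ e, f e ∧
    Realizes p (f + ∑ v, c v • edgeVec s(w, v)) m

theorem sum_univ_sum_edgeVec (F : Finset (Sym2 V)) :
    ∑ e, (∑ e' ∈ F, edgeVec e') e = (F.card : ZMod 2) := by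
  simp only [Finset.sum_apply]
  rw [Finset.sum_comm]
  simp [edgeVec]

theorem ReducesToStar.zero : ReducesToStar p w 0 0 :=
  ⟨0, by simpa using Realizes.zero⟩

theorem ReducesToStar.mono (h : ReducesToStar p w f m) (hm : m ≤ m') : ReducesToStar p w f m' :=
  let ⟨c, hw, hsum, hc⟩ := h
  ⟨c, hw, hsum, hc.mono hm⟩

theorem ReducesToStar.add (hf : ReducesToStar p w f m) (hg : ReducesToStar p w g m') :
    ReducesToStar p w (f + g) (m + m') := by
  obtain ⟨c, hw, hsum, hc⟩ := hf
  obtain ⟨d, hw', hsum', hd⟩ := hg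
  refine ⟨c + d, by simp [hw, hw'], by simp [Finset.sum_add_distrib, hsum, hsum'], ?_⟩
  convert hc.add hd using 1
  simp only [Pi.add_apply, add_smul, Finset.sum_add_distrib]
  ring

theorem ReducesToStar.sum {ι : Type*} {S : Finset ι} {f : ι → Sym2 V → ZMod 2}
    (h : ∀ i ∈ S, ReducesToStar p w (f i) m) : ReducesToStar p w (∑ i ∈ S, f i) (m * S.card) := by
  classical
  induction S using Finset.induction_on with
  | empty => exact ReducesToStar.zero
  | insert i S hi ih =>
    rw [Finset.forall_mem_insert] at h
    rw [Finset.sum_insert hi, Finset.card_insert_of_notMem hi, mul_add_one, add_comm (m * _)]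
    exact h.1.add (ih h.2)

theorem reducesToStar_of_sum {S : Finset V} (hw : w ∉ S) (hS : (S.card : ZMod 2) = ∑ e, f e)
    (h : Realizes p (f + starVec w S) m) : ReducesToStar p w f m := by
  refine ⟨fun v => if v ∈ S then 1 else 0, by simp [hw], by simp [← hS], ?_⟩
  simpa [starVec, ite_smul] using h

theorem reducesToStar_edgeVec_of_mem {e : Sym2 V} (he : ¬ e.IsDiag) (hw : w ∈ e) :
    ReducesToStar p w (edgeVec e) 0 := by
  obtain ⟨x, rfl⟩ := hw
  rw [Sym2.mk_isDiag_iff] at he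
  refine reducesToStar_of_sum (S := {x}) (by simpa using he) (by simp [edgeVec]) ?_
  convert Realizes.zero (V := V) (p := p) using 1
  rw [starVec, Finset.sum_singleton]
  linear_combination edgeVec s(w, x) * two_eq_zero

theorem reducesToStar_edgeVec (hp : 2 ≤ p) (hp_even : Even p) (hn : p + 2 ≤ Fintype.card V)
    {e : Sym2 V} (he : ¬ e.IsDiag) (hw : w ∉ e) :
    ReducesToStar p w (edgeVec e) (2 * p - 2) := by
  induction e using Sym2.ind with | _ a b
  rw [Sym2.mk_isDiag_iff] at he
  rw [Sym2.mem_iff, not_or] at hw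
  refine reducesToStar_of_sum (S := {b}) (by simpa using hw.2) (by simp [edgeVec]) ?_
  rw [starVec, Finset.sum_singleton, Sym2.eq_swap (a := w)]
  exact realizes_path hp hp_even hn he (Ne.symm hw.1) (Ne.symm hw.2)

theorem reducesToStar_edgeVec_add_edgeVec (hp : 2 ≤ p) (hn : p + 2 ≤ Fintype.card V)
    {e e' : Sym2 V} (hee' : e ≠ e') (he : ¬ e.IsDiag) (he' : ¬ e'.IsDiag) (hw : w ∉ e)
    (hw' : w ∉ e') (hadj : ∃ v, v ∈ e ∧ v ∈ e') :
    ReducesToStar p w (edgeVec e + edgeVec e') 4 := by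
  obtain ⟨v, ⟨x, rfl⟩, ⟨y, rfl⟩⟩ := hadj
  rw [Sym2.mk_isDiag_iff] at he he'
  rw [Sym2.mem_iff, not_or] at hw hw'
  have hxy : x ≠ y := fun hxy => hee' (hxy ▸ rfl)
  refine reducesToStar_of_sum (S := {x, y}) (by simp [hw.2, hw'.2]) ?_ ?_
  · simp [edgeVec, Finset.sum_add_distrib, Finset.card_pair hxy, one_add_one_eq_two]
  · rw [starVec, Finset.sum_pair hxy]
    convert realizes_fourCycle hp hn he (Ne.symm hw.1) he' (Ne.symm hw.2) hxy hw'.2 using 1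
    rw [Sym2.eq_swap (a := x), Sym2.eq_swap (a := y)]
    ring

omit [DecidableEq V] in
theorem two_mul_card_lt_of_pairwiseDisjoint (hdiag : ∀ e ∈ F, ¬ e.IsDiag) (hw : ∀ e ∈ F, w ∉ e)
    (hF : ∀ e ∈ F, ∀ e' ∈ F, e ≠ e' → ¬ ∃ v, v ∈ e ∧ v ∈ e') :
    2 * F.card < Fintype.card V := by
  classical
  have hcard : (F.biUnion Sym2.toFinset).card = 2 * F.card := by
    rw [Finset.card_biUnion, Finset.sum_congr rfl fun e he =>
      Sym2.card_toFinset_of_not_isDiag e (hdiag e he), Finset.sum_const, smul_eq_mul, mul_comm]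
    exact fun e he e' he' hne => Finset.disjoint_left.2 fun v hv hv' =>
      hF e he e' he' hne ⟨v, Sym2.mem_toFinset.1 hv, Sym2.mem_toFinset.1 hv'⟩
  rw [← hcard, Finset.card_lt_iff_ne_univ]
  refine fun h => absurd (h ▸ Finset.mem_univ w) ?_
  simpa using hw

theorem reducesToStar_sum_edgeVec_of_avoids (hp : 2 ≤ p) (hp_even : Even p)
    (hn : p + 2 ≤ Fintype.card V) (hdiag : ∀ e ∈ F, ¬ e.IsDiag) (hw : ∀ e ∈ F, w ∉ e) :
    ReducesToStar p w (∑ e ∈ F, edgeVec e) (2 * F.card + (p - 2) * (Fintype.card V - 1)) := by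
  induction F using Finset.strongInduction with
  | H F ih =>
    by_cases hadj : ∃ e ∈ F, ∃ e' ∈ F, e ≠ e' ∧ ∃ v, v ∈ e ∧ v ∈ e'
    · obtain ⟨e, he, e', he', hne, hadj⟩ := hadj
      have hsub : {e, e'} ⊆ F := by simp [Finset.insert_subset_iff, he, he']
      have hcard := Finset.card_sdiff_add_card_eq_card hsub
      rw [Finset.card_pair hne] at hcard
      rw [← Finset.sum_sdiff hsub, Finset.sum_pair hne]
      have hrest := ih (F \ {e, e'}) (Finset.sdiff_ssubset hsub (by simp))
        (fun e he => hdiag e (Finset.sdiff_subset he)) fun e he => hw e (Finset.sdiff_subset he)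
      exact (hrest.add (reducesToStar_edgeVec_add_edgeVec hp hn hne (hdiag e he) (hdiag e' he')
        (hw e he) (hw e' he') hadj)).mono (by omega)
    · push Not at hadj
      have hmatching := two_mul_card_lt_of_pairwiseDisjoint hdiag hw fun e he e' he' hne h =>
        let ⟨v, hv, hv'⟩ := h
        hadj e he e' he' hne v hv hv'
      refine (ReducesToStar.sum fun e he =>
        reducesToStar_edgeVec hp hp_even hn (hdiag e he) (hw e he)).mono ?_
      calc (2 * p - 2) * F.card = 2 * F.card + (p - 2) * (2 * F.card) := by
            obtain ⟨q, rfl⟩ := Nat.exists_eq_add_of_le' hp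
            rw [show 2 * (q + 2) - 2 = 2 * q + 2 by omega, Nat.add_sub_cancel]
            ring
        _ ≤ 2 * F.card + (p - 2) * (Fintype.card V - 1) := by gcongr; omega

theorem reducesToStar_sum_edgeVec (hp : 2 ≤ p) (hp_even : Even p) (hn : p + 2 ≤ Fintype.card V)
    (hdiag : ∀ e ∈ F, ¬ e.IsDiag) (w : V) :
    ReducesToStar p w (∑ e ∈ F, edgeVec e) (2 * F.card + (p - 2) * (Fintype.card V - 1)) := by
  rw [← Finset.sum_filter_add_sum_filter_not F (w ∈ ·)]
  have hle := Finset.card_filter_le F (w ∉ ·)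
  refine ((ReducesToStar.sum fun e he => ?_).add
    (reducesToStar_sum_edgeVec_of_avoids hp hp_even hn (fun e he => ?_) fun e he => ?_)).mono
    (by omega : 0 * _ + _ ≤ _)
  · rw [Finset.mem_filter] at he
    exact reducesToStar_edgeVec_of_mem (hdiag e he.1) he.2
  · exact hdiag e (Finset.mem_filter.1 he).1
  · exact (Finset.mem_filter.1 he).2

theorem realizes_starVec_of_even (hp : 2 ≤ p) (hp_even : Even p) (hn : p + 2 ≤ Fintype.card V)
    {S : Finset V} (hw : w ∉ S) (hS : Even S.card) :
    Realizes p (starVec w S) ((p - 1) * S.card) := by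
  refine Realizes.sum_of_even hS fun x hx y hy hxy => ?_
  rw [Sym2.eq_swap (a := w)]
  exact (realizes_path hp hp_even hn (ne_of_mem_of_not_mem hx hw) hxy
    (ne_of_mem_of_not_mem hy hw).symm).mono (by omega)

theorem ReducesToStar.realizes (hp : 2 ≤ p) (hp_even : Even p) (hn : p + 2 ≤ Fintype.card V)
    (h : ReducesToStar p w f m) (hf : ∑ e, f e = 0) :
    Realizes p f (m + (p - 1) * (Fintype.card V - 1)) := by
  obtain ⟨c, hw, hsum, hc⟩ := h
  have hc01 : ∀ v, c v = if c v ≠ 0 then 1 else 0 := fun v => by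
    generalize c v = x
    revert x
    decide
  set S : Finset V := {v | c v ≠ 0} with hS
  have hwS : w ∉ S := by simp [hS, hw]
  have hstar : ∑ v, c v • edgeVec s(w, v) = starVec w S := by
    rw [starVec, hS, Finset.sum_filter]
    exact Finset.sum_congr rfl fun v _ => by rw [hc01 v]; simp
  have hcard : S.card ≤ Fintype.card V - 1 := by
    have := Finset.card_lt_univ_of_notMem hwS
    omega
  have hSeven : Even S.card := by
    rw [← ZMod.natCast_eq_zero_iff_even, ← hf, ← hsum, hS, Finset.card_filter, Nat.cast_sum]
    exact Finset.sum_congr rfl fun v _ => by rw [hc01 v]; simp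
  rw [hstar] at hc
  convert (hc.add (realizes_starVec_of_even hp hp_even hn hwS hSeven)).mono
    (Nat.add_le_add_left (Nat.mul_le_mul_left (p - 1) hcard) m) using 1
  linear_combination -starVec w S * two_eq_zero

end StarReduction

section EvenReversal

theorem exists_even_subset_card_le {α : Type*} [DecidableEq α] (F : Finset α) :
    ∃ H ⊆ F, Even H.card ∧ (F \ H).card ≤ 1 := by
  rcases F.card.even_or_odd with hF | hF
  · exact ⟨F, subset_rfl, hF, by simp⟩
  · obtain ⟨e, he⟩ := Finset.card_pos.1 hF.pos
    refine ⟨F.erase e, F.erase_subset e, ?_, by simp [Finset.sdiff_erase he]⟩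
    rw [Finset.card_erase_of_mem he]
    exact hF.tsub_odd odd_one

variable {V : Type u} [Fintype V] [DecidableEq V] {p m : ℕ} {w : V}
  {f : Sym2 V → ZMod 2} {F : Finset (Sym2 V)}

theorem sum_sum_toFinset_eq_sum_smul {A : Type*} [AddCommGroup A] [Module (ZMod 2) A]
    (F : Finset (Sym2 V)) (h : V → A) :
    ∑ e ∈ F, ∑ v ∈ e.toFinset, h v = ∑ v, ((F.filter (v ∈ ·)).card : ZMod 2) • h v := by
  rw [Finset.sum_comm' (t' := Finset.univ) (s' := fun v => F.filter (v ∈ ·)) (by simp)]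
  simp [Nat.cast_smul_eq_nsmul]

omit [Fintype V] in
theorem Realizes.smul (h : Realizes p f m) (a : ZMod 2) : Realizes p (a • f) m := by
  rcases (by decide +revert : a = 0 ∨ a = 1) with rfl | rfl
  · simpa using Realizes.zero.mono m.zero_le
  · simpa using h

omit [Fintype V] in
theorem edgeVec_add_starVec_add_cliqueVec {Z : Finset V} (hwZ : w ∉ Z) {e : Sym2 V}
    (he : ¬ e.IsDiag) (hw : w ∉ e) (hZ : ∀ v ∈ e, v ∉ Z) :
    edgeVec e + starVec w e.toFinset + cliqueVec Z =
      cliqueVec (e.toFinset ∪ Z) + ∑ v ∈ e.toFinset, cliqueVec (insert w (insert v Z)) := by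
  induction e using Sym2.ind with | _ a b
  rw [Sym2.mk_isDiag_iff] at he
  simp only [Sym2.mem_iff, not_or, forall_eq_or_imp, forall_eq] at hw hZ
  rw [Sym2.toFinset_mk_eq, starVec, Finset.sum_pair he, Finset.sum_pair he, Finset.insert_union,
    Finset.singleton_union, cliqueVec_insert_insert he hZ.1 hZ.2,
    cliqueVec_insert_insert hw.1 hwZ hZ.1, cliqueVec_insert_insert hw.2 hwZ hZ.2]
  linear_combination -(starVec w Z + starVec a Z + starVec b Z + cliqueVec Z) * two_eq_zero

theorem sum_edgeVec_add_sum_smul_edgeVec {Z : Finset V} (hwZ : w ∉ Z) (hdiag : ∀ e ∈ F, ¬ e.IsDiag)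
    (hw : ∀ e ∈ F, w ∉ e) (hZ : ∀ e ∈ F, ∀ v ∈ e, v ∉ Z) (hF : Even F.card) :
    ∑ e ∈ F, edgeVec e + ∑ v, ((F.filter (v ∈ ·)).card : ZMod 2) • edgeVec s(w, v) =
      ∑ e ∈ F, cliqueVec (e.toFinset ∪ Z) +
        ∑ v, ((F.filter (v ∈ ·)).card : ZMod 2) • cliqueVec (insert w (insert v Z)) := by
  have hclique : ∑ _e ∈ F, cliqueVec Z = 0 := by
    rw [Finset.sum_const, ← Nat.cast_smul_eq_nsmul (ZMod 2),
      (ZMod.natCast_eq_zero_iff_even).2 hF, zero_smul]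
  rw [← sum_sum_toFinset_eq_sum_smul, ← sum_sum_toFinset_eq_sum_smul,
    ← add_zero (_ + ∑ e ∈ F, ∑ v ∈ e.toFinset, edgeVec s(w, v)), ← hclique]
  simp only [← Finset.sum_add_distrib]
  exact Finset.sum_congr rfl fun e he =>
    edgeVec_add_starVec_add_cliqueVec hwZ (hdiag e he) (hw e he) (hZ e he)

theorem reducesToStar_sum_edgeVec_of_avoids_insert {Z : Finset V} (hZ : Z.card + 2 = p)
    (hwZ : w ∉ Z) (hdiag : ∀ e ∈ F, ¬ e.IsDiag) (hwF : ∀ e ∈ F, w ∉ e)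
    (hZF : ∀ e ∈ F, ∀ v ∈ e, v ∉ Z) (hF : Even F.card) :
    ReducesToStar p w (∑ e ∈ F, edgeVec e) (F.card + Fintype.card V) := by
  have hedge : ∀ e ∈ F, Realizes p (cliqueVec (e.toFinset ∪ Z)) 1 := fun e he => by
    have hdisj : Disjoint e.toFinset Z := Finset.disjoint_left.2 fun v hv =>
      hZF e he v (Sym2.mem_toFinset.1 hv)
    have h := realizes_cliqueVec (e.toFinset ∪ Z)
    rwa [Finset.card_union_of_disjoint hdisj, Sym2.card_toFinset_of_not_isDiag e (hdiag e he),
      add_comm, hZ] at h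
  have hvertex : ∀ v, Realizes p
      (((F.filter (v ∈ ·)).card : ZMod 2) • cliqueVec (insert w (insert v Z))) 1 := fun v => by
    rcases (F.filter (v ∈ ·)).eq_empty_or_nonempty with hv | ⟨e, he⟩
    · simpa [hv] using Realizes.zero.mono zero_le_one
    · rw [Finset.mem_filter] at he
      have hvZ := hZF e he.1 v he.2
      have hwv : w ≠ v := fun h => hwF e he.1 (h ▸ he.2)
      rw [cliqueVec_insert_insert hwv hwZ hvZ]
      exact (realizes_cliqueVec_insert_insert hwv hwZ hvZ hZ).smul _
  refine ⟨fun v => (F.filter (v ∈ ·)).card, by simp [Finset.filter_false_of_mem hwF], ?_, ?_⟩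
  · have h := sum_sum_toFinset_eq_sum_smul F fun _ => (1 : ZMod 2)
    simp only [smul_eq_mul, mul_one] at h
    rw [← h, sum_univ_sum_edgeVec, (ZMod.natCast_eq_zero_iff_even).2 hF]
    refine Finset.sum_eq_zero fun e he => ?_
    simp [Sym2.card_toFinset_of_not_isDiag e (hdiag e he), CharTwo.two_eq_zero]
  · rw [sum_edgeVec_add_sum_smul_edgeVec hwZ hdiag hwF hZF hF]
    simpa only [one_mul, Finset.card_univ] using
      (Realizes.sum hedge).add (Realizes.sum (S := Finset.univ) fun v _ => hvertex v)

theorem card_filter_incident_le (hdiag : ∀ e ∈ F, ¬ e.IsDiag) (Y : Finset V) :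
    (F.filter fun e => ∃ v ∈ Y, v ∈ e).card ≤ Y.card * (Fintype.card V - 1) := by
  have hsub : (F.filter fun e => ∃ v ∈ Y, v ∈ e) ⊆
      Y.biUnion fun v => (Finset.univ.erase v).image fun x => s(v, x) := by
    intro e he
    obtain ⟨heF, v, hv, x, rfl⟩ := Finset.mem_filter.1 he
    have hvx := hdiag _ heF
    simp only [Finset.mem_biUnion, Finset.mem_image]
    exact ⟨v, hv, x, by simpa [eq_comm] using hvx, rfl⟩
  refine (Finset.card_le_card hsub).trans (Finset.card_biUnion_le_card_mul _ _ _ fun v _ => ?_)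
  exact Finset.card_image_le.trans_eq (Finset.card_erase_of_mem (Finset.mem_univ v))

theorem realizes_sum_edgeVec (hp : 2 ≤ p) (hp_even : Even p) (hn : p + 2 ≤ Fintype.card V)
    (hdiag : ∀ e ∈ F, ¬ e.IsDiag) (hF : Even F.card) :
    Realizes p (∑ e ∈ F, edgeVec e) ((2 * p - 2) * F.card) :=
  Realizes.sum_of_even hF fun e he e' he' =>
    realizes_edgeVec_add_edgeVec hp hp_even hn (hdiag e he) (hdiag e' he')

theorem realizes_sum_edgeVec_two_mul (hp : 2 ≤ p) (hp_even : Even p)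
    (hn : p + 2 ≤ Fintype.card V) (hdiag : ∀ e ∈ F, ¬ e.IsDiag) (hF : Even F.card) :
    Realizes p (∑ e ∈ F, edgeVec e) (2 * F.card + (2 * p - 3) * (Fintype.card V - 1)) := by
  obtain ⟨w⟩ : Nonempty V := Fintype.card_pos_iff.1 (by omega)
  refine ((reducesToStar_sum_edgeVec hp hp_even hn hdiag w).realizes hp hp_even hn ?_).mono ?_
  · rwa [sum_univ_sum_edgeVec, ZMod.natCast_eq_zero_iff_even]
  · rw [add_assoc, ← add_mul]
    gcongr
    omega

theorem realizes_sum_edgeVec_one_mul (hp : 2 ≤ p) (hp_even : Even p)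
    (hn : p + 2 ≤ Fintype.card V) (hdiag : ∀ e ∈ F, ¬ e.IsDiag) (hF : Even F.card) :
    Realizes p (∑ e ∈ F, edgeVec e)
      (F.card + 1 + Fintype.card V + (3 * p - 4) * (Fintype.card V - 1)) := by
  obtain ⟨w⟩ : Nonempty V := Fintype.card_pos_iff.1 (by omega)
  obtain ⟨Z, hwZ, hZ⟩ := exists_finset_disjoint_card_eq (X := {w}) (m := p - 2)
    (by rw [Finset.card_singleton]; omega)
  rw [Finset.disjoint_singleton_left] at hwZ
  set G := F.filter fun e => ¬ ∃ v ∈ insert w Z, v ∈ e with hG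
  obtain ⟨H, hHG, hH, hGH⟩ := exists_even_subset_card_le G
  have hHF : H ⊆ F := hHG.trans (Finset.filter_subset _ _)
  have hrest : (F \ H).card ≤ (p - 1) * (Fintype.card V - 1) + 1 := by
    have hincident := card_filter_incident_le hdiag (insert w Z)
    rw [Finset.card_insert_of_notMem hwZ, hZ, show p - 2 + 1 = p - 1 by omega] at hincident
    have hsplit := F.card_filter_add_card_filter_not fun e => ∃ v ∈ insert w Z, v ∈ e
    rw [← hG] at hsplit
    have := Finset.card_sdiff_add_card_eq_card hHF
    have := Finset.card_sdiff_add_card_eq_card hHG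
    omega
  have hcardH := Finset.card_sdiff_add_card_eq_card hHF
  have hHavoids : ∀ e ∈ H, ∀ v ∈ insert w Z, v ∉ e := fun e he v hv hve =>
    (Finset.mem_filter.1 (hHG he)).2 ⟨v, hv, hve⟩
  have hreduce := (reducesToStar_sum_edgeVec_of_avoids_insert (by omega) hwZ
    (fun e he => hdiag e (hHF he)) (fun e he => hHavoids e he w (Finset.mem_insert_self w Z))
    (fun e he v hve hv => hHavoids e he v (Finset.mem_insert_of_mem hv) hve) hH).add
    (reducesToStar_sum_edgeVec (F := F \ H) hp hp_even hn
      (fun e he => hdiag e (Finset.sdiff_subset he)) w)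
  rw [add_comm (∑ e ∈ H, _), Finset.sum_sdiff hHF] at hreduce
  refine (hreduce.realizes hp hp_even hn ?_).mono ?_
  · rwa [sum_univ_sum_edgeVec, ZMod.natCast_eq_zero_iff_even]
  · obtain ⟨q, rfl⟩ := Nat.exists_eq_add_of_le' hp
    rw [show 3 * (q + 2) - 4 = q + (q + 1) + (q + 1) by omega, add_mul, add_mul]
    rw [show q + 2 - 1 = q + 1 by omega, Nat.add_sub_cancel] at *
    omega

end EvenReversal

section Acyclicity

variable {V : Type u} {D : Digraph V} {f : Sym2 V → ZMod 2} {p m : ℕ}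

/-- The digraph obtained by reversing the arcs along the edges encoded by `f`. -/
def reverse (D : Digraph V) (f : Sym2 V → ZMod 2) : Digraph V where
  Adj u v := if f s(u, v) = 0 then D.Adj u v else D.Adj v u

theorem reverse_zero (D : Digraph V) : reverse D 0 = D := by
  ext u v
  simp [reverse]

theorem reverse_add (D : Digraph V) (f g : Sym2 V → ZMod 2) :
    reverse D (f + g) = reverse (reverse D f) g := by
  ext u v
  simp only [reverse, Pi.add_apply, Sym2.eq_swap (a := v)]
  have hadd : ∀ x y : ZMod 2, x + y = 0 ↔ (x = 0 ↔ y = 0) := by decide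
  by_cases hf : f s(u, v) = 0 <;> by_cases hg : g s(u, v) = 0 <;> simp [hadd, hf, hg]

theorem invert_eq_reverse [DecidableEq V] (D : Digraph V) (X : Finset V) :
    D.invert X = reverse D (cliqueVec X) := by
  ext u v
  rcases eq_or_ne u v with rfl | huv
  · simp [Digraph.invert, reverse, ← or_and_right, em]
  · by_cases h : u ∈ X ∧ v ∈ X <;>
      simp only [Digraph.invert, reverse, cliqueVec_mk, h] <;> simp [huv]

theorem invertFamily_eq_reverse [DecidableEq V] (D : Digraph V) (L : List (Finset V)) :
    D.invertFamily L = reverse D (L.map cliqueVec).sum := by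
  induction L generalizing D with
  | nil => exact (reverse_zero D).symm
  | cons X L ih =>
    rw [List.map_cons, List.sum_cons, reverse_add, ← invert_eq_reverse, ← ih]
    rfl

theorem eqInvNumber_le_of_realizes [DecidableEq V] (hD : (reverse D f).IsAcyclic)
    (hf : Realizes p f m) : D.eqInvNumber p ≤ m := by
  obtain ⟨L, hL, hm, rfl⟩ := hf
  rw [← invertFamily_eq_reverse] at hD
  exact (iInf₂_le L ⟨hL, hD⟩).trans (by exact_mod_cast hm)

theorem isAcyclic_of_lt {α : Type*} [Preorder α] (key : V → α)
    (h : ∀ u v, D.Adj u v → key u < key v) : D.IsAcyclic := fun v hv => by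
  have hlt := hv.lift key h
  rw [Relation.transGen_eq_self] at hlt
  exact lt_irrefl _ hlt

theorem exists_linearOrder_of_isAcyclic (hD : D.IsAcyclic) :
    ∃ _ : LinearOrder V, ∀ u v, D.Adj u v → u < v := by
  let _ : PartialOrder V :=
    { le := Relation.ReflTransGen D.Adj
      le_refl := fun _ => .refl
      le_trans := fun _ _ _ => .trans
      le_antisymm := fun u v huv hvu => by
        rcases Relation.reflTransGen_iff_eq_or_transGen.1 huv with h | h
        · exact h.symm
        · exact absurd (h.trans_left hvu) (hD u) }
  refine ⟨(inferInstance : LinearOrder (LinearExtension V)), fun u v huv => ?_⟩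
  refine lt_of_le_of_ne (toLinearExtension.monotone (Relation.ReflTransGen.single huv)) ?_
  rintro rfl
  exact hD u (.single huv)

theorem exists_isFeedbackArcSet_card_eq_fas [Finite V] (D : Digraph V) :
    ∃ F : Finset (V × V), D.IsFeedbackArcSet F ∧ F.card = D.fas := by
  classical
  have := Fintype.ofFinite V
  refine Nat.sInf_mem (s := {m | ∃ F : Finset (V × V), D.IsFeedbackArcSet F ∧ F.card = m})
    ⟨_, Finset.univ.filter fun q : V × V => D.Adj q.1 q.2, ⟨by simp, ?_⟩, rfl⟩
  exact isAcyclic_of_lt (fun _ => 0) fun u v huv => absurd huv.1 (by simpa using huv.2)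

theorem sum_edgeVec_apply [DecidableEq V] (F : Finset (Sym2 V)) (e : Sym2 V) :
    (∑ e' ∈ F, edgeVec e') e = if e ∈ F then 1 else 0 := by
  simp [edgeVec, Finset.sum_apply, Pi.single_apply]

-- The reversed edges are the arcs of a minimum feedback arc set that go backwards in a linear
-- order in which all the other arcs go forwards.
theorem exists_isAcyclic_reverse_card_le_fas [Finite V] [DecidableEq V] (hD : D.IsOriented) :
    ∃ F : Finset (Sym2 V), (∀ e ∈ F, ¬ e.IsDiag) ∧ F.card ≤ D.fas ∧
      (reverse D (∑ e ∈ F, edgeVec e)).IsAcyclic := by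
  obtain ⟨A, ⟨hAD, hA⟩, hcard⟩ := exists_isFeedbackArcSet_card_eq_fas D
  obtain ⟨_, hlt⟩ := exists_linearOrder_of_isAcyclic hA
  set B := (A.filter fun q => q.2 < q.1).image fun q => s(q.1, q.2) with hB
  have hmem : ∀ u v, s(u, v) ∈ B ↔ ((u, v) ∈ A ∧ v < u) ∨ ((v, u) ∈ A ∧ u < v) := by
    intro u v
    simp only [hB, Finset.mem_image, Finset.mem_filter, Prod.exists, Sym2.eq_iff]
    grind
  refine ⟨B, fun e he => ?_, ?_, isAcyclic_of_lt id fun u v huv => ?_⟩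
  · induction e using Sym2.ind with | _ u v
    rw [Sym2.mk_isDiag_iff]
    rintro rfl
    simp [hmem] at he
  · exact hcard ▸ Finset.card_image_le.trans (Finset.card_filter_le _ _)
  · simp only [reverse, sum_edgeVec_apply] at huv
    by_cases huvB : s(u, v) ∈ B
    · have hvu : D.Adj v u := by simpa [huvB] using huv
      rcases (hmem u v).1 huvB with ⟨huvA, -⟩ | ⟨-, h⟩
      · exact absurd (hAD _ huvA) (hD v u hvu)
      · exact h
    · have huv' : D.Adj u v := by simpa [huvB] using huv
      by_cases huvA : (u, v) ∈ A
      · refine lt_of_le_of_ne (not_lt.1 fun h => huvB ((hmem u v).2 (.inl ⟨huvA, h⟩))) ?_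
        rintro rfl
        exact hD u u huv' huv'
      · exact hlt u v ⟨huv', huvA⟩

theorem swap_lt_swap_of_covBy {α : Type*} [DecidableEq α] [LinearOrder α] {a b u v : α}
    (hab : a ⋖ b) (huv : u < v) (hne : s(u, v) ≠ s(a, b)) :
    Equiv.swap a b u < Equiv.swap a b v := by
  have := hab.lt
  have := @hab.2 u
  have := @hab.2 v
  simp only [Equiv.swap_apply_def]
  grind

theorem exists_isAcyclic_reverse_edgeVec [Finite V] [Nontrivial V] [DecidableEq V]
    (hD : D.IsAcyclic) :
    ∃ a b : V, a ≠ b ∧ (reverse D (edgeVec s(a, b))).IsAcyclic := by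
  obtain ⟨_, hlt⟩ := exists_linearOrder_of_isAcyclic hD
  obtain ⟨x, y, hxy⟩ := exists_pair_lt V
  obtain ⟨b, hab⟩ := exists_covBy_of_wellFoundedLT (not_isMax_of_lt hxy)
  refine ⟨x, b, hab.ne, isAcyclic_of_lt (Equiv.swap x b) fun u v huv => ?_⟩
  by_cases hs : s(u, v) = s(x, b)
  · have hvu := hlt v u (by simpa [reverse, edgeVec, hs] using huv)
    rcases Sym2.eq_iff.1 hs with ⟨rfl, rfl⟩ | ⟨rfl, rfl⟩
    · exact absurd hvu hab.lt.asymm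
    · simpa using hvu
  · exact swap_lt_swap_of_covBy hab (hlt u v (by simpa [reverse, edgeVec, hs] using huv)) hs

theorem exists_even_isAcyclic_reverse [Finite V] [Nontrivial V] [DecidableEq V]
    (hD : D.IsOriented) :
    ∃ F : Finset (Sym2 V), (∀ e ∈ F, ¬ e.IsDiag) ∧ Even F.card ∧ F.card ≤ D.fas + 1 ∧
      (reverse D (∑ e ∈ F, edgeVec e)).IsAcyclic := by
  obtain ⟨B, hdiag, hcard, hB⟩ := exists_isAcyclic_reverse_card_le_fas hD
  rcases B.card.even_or_odd with heven | hodd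
  · exact ⟨B, hdiag, heven, by omega, hB⟩
  obtain ⟨a, b, hab, hacyc⟩ := exists_isAcyclic_reverse_edgeVec hB
  rw [← reverse_add] at hacyc
  by_cases hmem : s(a, b) ∈ B
  · refine ⟨B.erase s(a, b), fun e he => hdiag e (Finset.mem_of_mem_erase he), ?_, ?_, ?_⟩
    · rw [Finset.card_erase_of_mem hmem]
      exact hodd.tsub_odd odd_one
    · exact (Finset.card_erase_le.trans hcard).trans (Nat.le_succ _)
    · convert hacyc using 2
      rw [← Finset.sum_erase_add _ _ hmem]
      linear_combination -edgeVec s(a, b) * two_eq_zero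
  · refine ⟨insert s(a, b) B, ?_, ?_, ?_, ?_⟩
    · exact (Finset.forall_mem_insert _ _ _).2 ⟨by simpa using hab, hdiag⟩
    · rw [Finset.card_insert_of_notMem hmem]
      exact hodd.add_one
    · rw [Finset.card_insert_of_notMem hmem]
      omega
    · rwa [Finset.sum_insert hmem, add_comm]

end Acyclicity

section BipartiteExtremal

variable {W : Type*} [Finite W] {H : SimpleGraph W}

-- Deleting a vertex of minimum degree reduces to graphs with one vertex fewer.
theorem eventually_extremalNumber_succ_le (hH : H.IsBipartite) {ε : ℝ} (hε : 0 < ε) :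
    ∀ᶠ n : ℕ in atTop, (SimpleGraph.extremalNumber (n + 1) H : ℝ) ≤
      SimpleGraph.extremalNumber n H + ε * (n + 1) := by
  classical
  have := Fintype.ofFinite W
  obtain ⟨C⟩ := hH
  have hcontained := SimpleGraph.isContained_completeEquipartiteGraph_of_colorable C
    (Fintype.card W) fun c => Fintype.card_subtype_le _
  have hES := SimpleGraph.eventually_completeEquipartiteGraph_isContained_of_minDegree hε 1
    (Fintype.card W)
  filter_upwards [(tendsto_add_atTop_nat 1).eventually hES] with n hn
  rw [← Fintype.card_fin (n + 1), SimpleGraph.extremalNumber_le_iff_of_nonneg _ (by positivity)]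
  intro G _ hG
  obtain ⟨v, hv⟩ := G.exists_minimal_degree_vertex
  have hdegree : (G.degree v : ℝ) < ε * (n + 1) := by
    rw [← hv]
    refine not_le.1 fun h => hG (hcontained.trans (hn ?_))
    simpa using h
  have hdelete := SimpleGraph.card_edgeFinset_deleteIncidenceSet_le_extremalNumber hG v
  rw [SimpleGraph.card_edgeFinset_deleteIncidenceSet, Fintype.card_fin, Nat.add_sub_cancel,
    Nat.sub_le_iff_le_add] at hdelete
  have hdelete' : (G.edgeFinset.card : ℝ) ≤ SimpleGraph.extremalNumber n H + G.degree v := by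
    exact_mod_cast hdelete
  linarith

theorem isLittleO_extremalNumber (hH : H.IsBipartite) :
    (fun n : ℕ => (SimpleGraph.extremalNumber n H : ℝ)) =o[atTop] fun n : ℕ => (n : ℝ) ^ 2 := by
  refine isLittleO_iff.2 fun c hc => ?_
  obtain ⟨N, hN⟩ := eventually_atTop.1 (eventually_extremalNumber_succ_le hH (half_pos hc))
  have hbound : ∀ n ≥ N, (SimpleGraph.extremalNumber n H : ℝ) ≤
      SimpleGraph.extremalNumber N H + c / 2 * n ^ 2 := by
    intro n hn
    induction n, hn using Nat.le_induction with
    | base => exact le_add_of_nonneg_right (by positivity)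
    | succ n hn ih =>
      have hstep := hN n hn
      have : 0 ≤ c / 2 * n := by positivity
      push_cast
      linarith
  have hlarge : ∀ᶠ n : ℕ in atTop, (SimpleGraph.extremalNumber N H : ℝ) ≤ c / 2 * n ^ 2 :=
    (((tendsto_pow_atTop two_ne_zero).comp tendsto_natCast_atTop_atTop).const_mul_atTop
      (half_pos hc)).eventually_ge_atTop _
  filter_upwards [eventually_ge_atTop N, hlarge] with n hn hn'
  rw [Real.norm_of_nonneg (Nat.cast_nonneg _), Real.norm_of_nonneg (by positivity)]
  linarith [hbound n hn]

end BipartiteExtremal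

section Packing

variable {V : Type u} [DecidableEq V] {p : ℕ}

theorem joinVec_union_left {A A' : Finset V} (h : Disjoint A A') (B : Finset V) :
    joinVec (A ∪ A') B = joinVec A B + joinVec A' B :=
  Finset.sum_union h

theorem joinVec_union_right (A : Finset V) {B B' : Finset V} (h : Disjoint B B') :
    joinVec A (B ∪ B') = joinVec A B + joinVec A B' := by
  simp only [joinVec, starVec, Finset.sum_union h, Finset.sum_add_distrib]

theorem realizes_joinVec {A B : Finset V} (hp_even : Even p) (hAB : Disjoint A B)
    (hA : A.card = p) (hB : B.card = p) : Realizes p (joinVec A B) 4 := by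
  obtain ⟨q, rfl⟩ := hp_even
  obtain ⟨A₁, hA₁, hA₁q⟩ := Finset.exists_subset_card_eq (by omega : q ≤ A.card)
  obtain ⟨B₁, hB₁, hB₁q⟩ := Finset.exists_subset_card_eq (by omega : q ≤ B.card)
  obtain ⟨A₂, hA₂⟩ : ∃ A₂, A₂ = A \ A₁ := ⟨_, rfl⟩
  obtain ⟨B₂, hB₂⟩ : ∃ B₂, B₂ = B \ B₁ := ⟨_, rfl⟩
  have hAd : Disjoint A₁ A₂ := hA₂ ▸ Finset.disjoint_sdiff
  have hBd : Disjoint B₁ B₂ := hB₂ ▸ Finset.disjoint_sdiff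
  obtain rfl : A₁ ∪ A₂ = A := by rw [hA₂, Finset.union_sdiff_of_subset hA₁]
  obtain rfl : B₁ ∪ B₂ = B := by rw [hB₂, Finset.union_sdiff_of_subset hB₁]
  rw [Finset.card_union_of_disjoint hAd] at hA
  rw [Finset.card_union_of_disjoint hBd] at hB
  simp only [Finset.disjoint_union_left, Finset.disjoint_union_right] at hAB
  obtain ⟨⟨h₁₁, h₂₁⟩, h₁₂, h₂₂⟩ := hAB
  have hunion {X Y : Finset V} (hXY : Disjoint X Y) (hcard : X.card + Y.card = q + q) :
      Realizes (q + q) (cliqueVec X + cliqueVec Y + joinVec X Y) 1 := by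
    rw [← cliqueVec_union hXY, ← hcard, ← Finset.card_union_of_disjoint hXY]
    exact realizes_cliqueVec _
  convert ((hunion h₁₁ (by omega)).add (hunion h₁₂ (by omega))).add
    ((hunion h₂₁ (by omega)).add (hunion h₂₂ (by omega))) using 1
  rw [joinVec_union_left hAd, joinVec_union_right _ hBd, joinVec_union_right _ hBd]
  linear_combination
    -(cliqueVec A₁ + cliqueVec A₂ + cliqueVec B₁ + cliqueVec B₂) * two_eq_zero

/-- The set of the edges with one end in `A` and the other in `B`. -/
def edgesBetween (A B : Finset V) : Finset (Sym2 V) :=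
  (A ×ˢ B).image fun q => s(q.1, q.2)

theorem sum_edgesBetween {M : Type*} [AddCommMonoid M] {A B : Finset V} (hAB : Disjoint A B)
    (f : Sym2 V → M) : ∑ e ∈ edgesBetween A B, f e = ∑ a ∈ A, ∑ b ∈ B, f s(a, b) := by
  rw [edgesBetween, Finset.sum_image, Finset.sum_product]
  rintro ⟨a, b⟩ h ⟨a', b'⟩ h' heq
  have := Finset.disjoint_left.1 hAB
  simp only [Sym2.eq_iff, Finset.coe_product, Set.mem_prod, Finset.mem_coe] at *
  grind

theorem card_edgesBetween {A B : Finset V} (hAB : Disjoint A B) :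
    (edgesBetween A B).card = A.card * B.card := by
  rw [Finset.card_eq_sum_ones, sum_edgesBetween hAB]
  simp

theorem exists_edgesBetween_subset_of_not_free {α β : Type*} [Fintype α] [Fintype β]
    {F : Finset (Sym2 V)}
    (hF : ¬ (completeBipartiteGraph α β).Free (SimpleGraph.fromEdgeSet (F : Set (Sym2 V)))) :
    ∃ A B : Finset V, Disjoint A B ∧ A.card = Fintype.card α ∧ B.card = Fintype.card β ∧
      edgesBetween A B ⊆ F := by
  obtain ⟨A, B, hA, hB, hAB⟩ :=
    SimpleGraph.completeBipartiteGraph_isContained_iff.1 (not_not.1 hF)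
  refine ⟨A, B, Finset.disjoint_coe.1 hAB.disjoint, hA, hB,
    Finset.image_subset_iff.2 fun q hq => ?_⟩
  rw [Finset.mem_product] at hq
  exact ((SimpleGraph.fromEdgeSet_adj _).1 (hAB hq.1 hq.2)).1

-- Greedily remove copies of `K_{p,p}`, each of which costs four inversions.
theorem exists_free_subset_realizes_sum_sdiff (hp : 0 < p) (hp_even : Even p)
    (F : Finset (Sym2 V)) :
    ∃ R ⊆ F,
      (completeBipartiteGraph (Fin p) (Fin p)).Free (SimpleGraph.fromEdgeSet (R : Set (Sym2 V))) ∧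
      ∃ k, F.card = R.card + k * p ^ 2 ∧ Realizes p (∑ e ∈ F \ R, edgeVec e) (4 * k) := by
  induction F using Finset.strongInduction with
  | H F ih =>
    by_cases hF : (completeBipartiteGraph (Fin p) (Fin p)).Free
      (SimpleGraph.fromEdgeSet (F : Set (Sym2 V)))
    · exact ⟨F, subset_rfl, hF, 0, by simp, by simpa using Realizes.zero⟩
    obtain ⟨A, B, hAB, hA, hB, hsub⟩ := exists_edgesBetween_subset_of_not_free hF
    rw [Fintype.card_fin] at hA hB
    set K := edgesBetween A B
    have hKcard : K.card = p ^ 2 := by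
      rw [card_edgesBetween hAB, hA, hB, sq]
    have hKne : K.Nonempty := Finset.card_pos.1 (hKcard ▸ by positivity)
    obtain ⟨R, hR, hfree, k, hk, hrealizes⟩ := ih (F \ K) (Finset.sdiff_ssubset hsub hKne)
    have hKR : K ⊆ F \ R := Finset.subset_sdiff.2 ⟨hsub, (Finset.subset_sdiff.1 hR).2.symm⟩
    refine ⟨R, hR.trans Finset.sdiff_subset, hfree, k + 1, ?_, ?_⟩
    · rw [← Finset.card_sdiff_add_card_eq_card hsub, hk, hKcard]
      ring
    · rw [← Finset.sum_sdiff hKR, sum_edgesBetween hAB, sdiff_right_comm]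
      exact hrealizes.add (realizes_joinVec hp_even hAB hA hB)

end Packing

theorem card_le_extremalNumber_of_free {V W : Type*} [Fintype V] {H : SimpleGraph W}
    {R : Finset (Sym2 V)} (hdiag : ∀ e ∈ R, ¬ e.IsDiag)
    (hR : H.Free (SimpleGraph.fromEdgeSet (R : Set (Sym2 V)))) :
    R.card ≤ SimpleGraph.extremalNumber (Fintype.card V) H := by
  classical
  refine (Finset.card_le_card fun e he => ?_).trans
    (SimpleGraph.card_edgeFinset_le_extremalNumber hR)
  simpa using ⟨he, hdiag e he⟩

section Bounds

variable {V : Type u} [Fintype V] {D : Digraph V} {p : ℕ}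

theorem eqInvNumber_le_mul_fas_add_one (hp : 2 ≤ p) (hp_even : Even p) (hD : D.IsOriented)
    (hn : p + 2 ≤ Fintype.card V) :
    D.eqInvNumber p ≤ (((2 * p - 2) * (D.fas + 1) : ℕ) : ℕ∞) := by
  classical
  have : Nontrivial V := Fintype.one_lt_card_iff_nontrivial.1 (by omega)
  obtain ⟨F, hdiag, hF, hcard, hacyc⟩ := exists_even_isAcyclic_reverse hD
  exact eqInvNumber_le_of_realizes hacyc
    ((realizes_sum_edgeVec hp hp_even hn hdiag hF).mono (Nat.mul_le_mul_left _ hcard))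

theorem eqInvNumber_le_two_mul_fas_add (hp : 2 ≤ p) (hp_even : Even p) (hD : D.IsOriented)
    (hn : p + 2 ≤ Fintype.card V) :
    D.eqInvNumber p ≤ ((2 * D.fas + 2 * p * Fintype.card V : ℕ) : ℕ∞) := by
  classical
  have : Nontrivial V := Fintype.one_lt_card_iff_nontrivial.1 (by omega)
  obtain ⟨F, hdiag, hF, hcard, hacyc⟩ := exists_even_isAcyclic_reverse hD
  refine eqInvNumber_le_of_realizes hacyc
    ((realizes_sum_edgeVec_two_mul hp hp_even hn hdiag hF).mono ?_)
  have : (2 * p - 3) * (Fintype.card V - 1) ≤ (2 * p - 3) * Fintype.card V := by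
    gcongr
    omega
  have : (2 * p - 3) * Fintype.card V + 3 * Fintype.card V = 2 * p * Fintype.card V := by
    rw [← add_mul, Nat.sub_add_cancel (by omega)]
  omega

theorem eqInvNumber_le_fas_add (hp : 2 ≤ p) (hp_even : Even p) (hD : D.IsOriented)
    (hn : p + 2 ≤ Fintype.card V) :
    D.eqInvNumber p ≤ ((D.fas + 3 * (p - 1) * Fintype.card V : ℕ) : ℕ∞) := by
  classical
  have : Nontrivial V := Fintype.one_lt_card_iff_nontrivial.1 (by omega)
  obtain ⟨F, hdiag, hF, hcard, hacyc⟩ := exists_even_isAcyclic_reverse hD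
  refine eqInvNumber_le_of_realizes hacyc
    ((realizes_sum_edgeVec_one_mul hp hp_even hn hdiag hF).mono ?_)
  have : (3 * p - 4) * (Fintype.card V - 1) + (3 * p - 4) = (3 * p - 4) * Fintype.card V := by
    rw [← Nat.mul_succ, Nat.succ_eq_add_one, Nat.sub_add_cancel (by omega)]
  have : (3 * p - 4) * Fintype.card V + Fintype.card V = 3 * (p - 1) * Fintype.card V := by
    rw [← Nat.succ_mul]
    congr 1
    omega
  omega

theorem eqInvNumber_le_four_mul_div_add (hp : 2 ≤ p) (hp_even : Even p) (hD : D.IsOriented)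
    (hn : p + 2 ≤ Fintype.card V) :
    D.eqInvNumber p ≤ ((4 * ((D.fas + 1) / p ^ 2) + (2 * p - 2) *
      SimpleGraph.extremalNumber (Fintype.card V) (completeBipartiteGraph (Fin p) (Fin p)) : ℕ) :
        ℕ∞) := by
  classical
  have : Nontrivial V := Fintype.one_lt_card_iff_nontrivial.1 (by omega)
  obtain ⟨F, hdiag, hF, hcard, hacyc⟩ := exists_even_isAcyclic_reverse hD
  obtain ⟨R, hRF, hfree, k, hk, hpacking⟩ :=
    exists_free_subset_realizes_sum_sdiff (by omega) hp_even F
  have hRdiag : ∀ e ∈ R, ¬ e.IsDiag := fun e he => hdiag e (hRF he)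
  have hReven : Even R.card := by
    rw [hk, Nat.even_add] at hF
    exact hF.2 ((hp_even.pow_of_ne_zero two_ne_zero).mul_left k)
  have hrealizes := hpacking.add (realizes_sum_edgeVec hp hp_even hn hRdiag hReven)
  rw [Finset.sum_sdiff hRF] at hrealizes
  refine eqInvNumber_le_of_realizes hacyc (hrealizes.mono ?_)
  gcongr
  · rw [Nat.le_div_iff_mul_le (by positivity)]
    omega
  · exact card_le_extremalNumber_of_free hRdiag hfree

end Bounds

section RealBounds

theorem exists_natCast_eq_and_le {x : ℕ∞} {a : ℕ} {b : ℝ} (hx : x ≤ a) (hab : a ≤ b) :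
    ∃ m : ℕ, x = m ∧ (m : ℝ) ≤ b := by
  obtain ⟨m, rfl⟩ := ENat.ne_top_iff_exists.1 (ne_top_of_le_ne_top (ENat.natCast_ne_top a) hx)
  exact ⟨m, rfl, le_trans (by exact_mod_cast hx) hab⟩

-- For `k = 1` the power of `n` dominates because `6 ≤ n`, for `k ≥ 2` the term with `2 ^ (k ^ 2)`
-- does.
theorem three_mul_sub_one_mul_le {p n : ℝ} {k : ℕ} (hp : 4 ≤ p) (hn : 6 ≤ n) (hk : 1 ≤ k) :
    3 * (p - 1) * n ≤ (p - 2) / 2 * n ^ (1 + 1 / (k : ℝ)) +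
      ((p - 2) * 2 ^ (k ^ 2) + (p - 1) / 2) * n := by
  have hlinear : 3 * (p - 1) * n ≤ (5 * (p - 2) + (p - 1) / 2) * n := by
    gcongr
    linarith
  refine hlinear.trans ?_
  rcases hk.eq_or_lt with rfl | hk
  · have hpow : n ^ (1 + 1 / ((1 : ℕ) : ℝ)) = n * n := by
      rw [show (1 + 1 / ((1 : ℕ) : ℝ)) = ((2 : ℕ) : ℝ) by norm_num, Real.rpow_natCast, sq]
    have hsq : (p - 2) / 2 * (6 * n) ≤ (p - 2) / 2 * (n * n) := by
      have : 0 ≤ (p - 2) / 2 := by linarith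
      gcongr
    rw [hpow]
    norm_num
    linarith
  · have hpow : 0 ≤ (p - 2) / 2 * n ^ (1 + 1 / (k : ℝ)) :=
      mul_nonneg (by linarith) (Real.rpow_nonneg (by linarith) _)
    have htwo : (5 : ℝ) ≤ 2 ^ (k ^ 2) :=
      calc (5 : ℝ) ≤ 2 ^ 4 := by norm_num
        _ ≤ 2 ^ (k ^ 2) := pow_le_pow_right₀ one_le_two (by nlinarith)
    have hcoeff : (5 * (p - 2) + (p - 1) / 2) * n ≤ ((p - 2) * 2 ^ (k ^ 2) + (p - 1) / 2) * n := by
      rw [mul_comm 5]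
      have : 0 ≤ p - 2 := by linarith
      gcongr
    linarith

theorem add_three_mul_pred_mul_le {p n k : ℕ} (hp : 4 ≤ p) (hn : 6 ≤ n) (hk : 1 ≤ k) (m : ℕ) :
    ((m + 3 * (p - 1) * n : ℕ) : ℝ) ≤ m + ((p : ℝ) - 2) / 2 * (n : ℝ) ^ (1 + 1 / (k : ℝ)) +
      (((p : ℝ) - 2) * 2 ^ (k ^ 2) + ((p : ℝ) - 1) / 2) * n := by
  push_cast [Nat.cast_sub (by omega : 1 ≤ p)]
  rw [add_assoc]
  gcongr
  exact three_mul_sub_one_mul_le (by exact_mod_cast hp) (by exact_mod_cast hn) hk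

theorem four_mul_div_sq_le_div_ceil_mul_floor {p : ℕ} (hp_even : Even p) (m : ℕ) :
    ((4 * ((m + 1) / p ^ 2) : ℕ) : ℝ) ≤
      m / ((⌈(p : ℝ) / 2⌉₊ : ℝ) * (⌊(p : ℝ) / 2⌋₊ : ℝ)) + 4 / (p : ℝ) ^ 2 := by
  obtain ⟨q, rfl⟩ := hp_even
  have hhalf : ((q + q : ℕ) : ℝ) / 2 = q := by
    push_cast
    ring
  have hdiv : (((m + 1) / (q + q) ^ 2 : ℕ) : ℝ) ≤ ((m + 1 : ℕ) : ℝ) / (((q + q) ^ 2 : ℕ) : ℝ) :=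
    Nat.cast_div_le
  rw [hhalf, Nat.ceil_natCast, Nat.floor_natCast]
  calc ((4 * ((m + 1) / (q + q) ^ 2) : ℕ) : ℝ)
      ≤ 4 * (((m + 1 : ℕ) : ℝ) / (((q + q) ^ 2 : ℕ) : ℝ)) := by
        push_cast at hdiv ⊢
        gcongr
    _ = m / ((q : ℝ) * q) + 4 / ((q + q : ℕ) : ℝ) ^ 2 := by
        rcases eq_or_ne q 0 with rfl | hq
        · simp
        push_cast
        field_simp
        ring

theorem isLittleO_const_add_mul_extremalNumber (p : ℕ) (a b : ℝ) :
    (fun n : ℕ => a + b * (SimpleGraph.extremalNumber n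
      (completeBipartiteGraph (Fin p) (Fin p)) : ℝ)) =o[atTop] fun n : ℕ => (n : ℝ) ^ 2 := by
  have hconst : (fun _ : ℕ => a) =o[atTop] fun n : ℕ => (n : ℝ) ^ 2 :=
    isLittleO_const_left.2 <| Or.inr <| tendsto_norm_atTop_atTop.comp <|
      (tendsto_pow_atTop two_ne_zero).comp tendsto_natCast_atTop_atTop
  exact hconst.add ((isLittleO_extremalNumber
    (SimpleGraph.CompleteBipartiteGraph.bicoloring _ _).colorable).const_mul_left b)

end RealBounds

end EqInversion

open EqInversion in
theorem theorem5_general (p : ℕ) (hp : 2 ≤ p) (hp_even : Even p) :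
    (∀ (V : Type u) [Fintype V] (D : Digraph V), D.IsOriented → p + 2 ≤ Fintype.card V →
      D.eqInvNumber p ≤ (((2 * p - 2) * (D.fas + 1) : ℕ) : ℕ∞) ∧
      D.eqInvNumber p ≤ ((2 * D.fas + 2 * p * Fintype.card V : ℕ) : ℕ∞) ∧
      D.eqInvNumber p ≤ ((D.fas + 3 * (p - 1) * Fintype.card V : ℕ) : ℕ∞)) ∧
    (∃ g : ℕ → ℝ, g =o[atTop] (fun n : ℕ => (n : ℝ) ^ 2) ∧
      ∀ (V : Type u) [Fintype V] (D : Digraph V), D.IsOriented → p + 2 ≤ Fintype.card V →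
        ∃ m : ℕ, D.eqInvNumber p = (m : ℕ∞) ∧
          (m : ℝ) ≤ (D.fas : ℝ) / ((⌈(p : ℝ) / 2⌉₊ : ℝ) * (⌊(p : ℝ) / 2⌋₊ : ℝ))
            + g (Fintype.card V)) := by
  refine ⟨fun V _ D hD hn => ⟨eqInvNumber_le_mul_fas_add_one hp hp_even hD hn,
    eqInvNumber_le_two_mul_fas_add hp hp_even hD hn, eqInvNumber_le_fas_add hp hp_even hD hn⟩,
    _, isLittleO_const_add_mul_extremalNumber p (4 / (p : ℝ) ^ 2) ((2 * p - 2 : ℕ) : ℝ),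
    fun V _ D hD hn => ?_⟩
  refine exists_natCast_eq_and_le (eqInvNumber_le_four_mul_div_add hp hp_even hD hn) ?_
  rw [Nat.cast_add, Nat.cast_mul (2 * p - 2), ← add_assoc]
  gcongr
  exact four_mul_div_sq_le_div_ceil_mul_floor hp_even D.fas

theorem theorem5 (p : ℕ) (hp : 4 ≤ p) (hp_even : Even p) :
    (∀ (V : Type u) [Fintype V] (D : Digraph V), D.IsOriented → p + 2 ≤ Fintype.card V →
      -- (i)
      D.eqInvNumber p ≤ (((2 * p - 2) * (D.fas + 1) : ℕ) : ℕ∞) ∧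
      -- (ii)
      D.eqInvNumber p ≤ ((2 * D.fas + 2 * p * Fintype.card V : ℕ) : ℕ∞) ∧
      -- (iii)
      (∀ k : ℕ, 1 ≤ k → p + 2 * k ≤ Fintype.card V + 2 →
        ∃ m : ℕ, D.eqInvNumber p = (m : ℕ∞) ∧
          (m : ℝ) ≤ (D.fas : ℝ)
            + ((p : ℝ) - 2) / 2 * (Fintype.card V : ℝ) ^ (1 + 1 / (k : ℝ))
            + (((p : ℝ) - 2) * (2 : ℝ) ^ (k ^ 2) + ((p : ℝ) - 1) / 2) * (Fintype.card V : ℝ)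
            + 1)) ∧
    -- (iv)
    (∃ g : ℕ → ℝ, g =o[atTop] (fun n : ℕ => (n : ℝ) ^ 2) ∧
      ∀ (V : Type u) [Fintype V] (D : Digraph V), D.IsOriented → p + 2 ≤ Fintype.card V →
        ∃ m : ℕ, D.eqInvNumber p = (m : ℕ∞) ∧
          (m : ℝ) ≤ (D.fas : ℝ) / ((⌈(p : ℝ) / 2⌉₊ : ℝ) * (⌊(p : ℝ) / 2⌋₊ : ℝ))
            + g (Fintype.card V)) := by
  obtain ⟨h, hg⟩ := theorem5_general.{u} p (by omega) hp_even
  exact ⟨fun V _ D hD hn => ⟨(h V D hD hn).1, (h V D hD hn).2.1, fun k hk _ =>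
    EqInversion.exists_natCast_eq_and_le (h V D hD hn).2.2 (le_add_of_le_of_nonneg
      (EqInversion.add_three_mul_pred_mul_le hp (by omega) hk D.fas) zero_le_one)⟩, hg⟩
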